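/- Let $(X,\mathcal X,\mu)$ be a probability space, let $d\ge 1$, and let $S_1,\dots,S_d$ be invertible (with measurable inverse) measure-preserving transformations of $X$ that commute: $S_iS_k=S_kS_i$ for all $i,k$. Let $f_1,\dots,f_d\in L^\infty(\mu)$ be real-valued, and for $n\in\mathbb Z$ write $S_i^nf_i:=f_i\circ S_i^n$. Let $(I_j)_{j\ge1}$ be any sequence of finite intervals in $\mathbb Z$ whose lengths (numbers of elements) $|I_j|$ tend to infinity. Then the averages $$\frac1{|I_j|}\sum_{n\in I_j}S_1^nf_1\cdot S_2^nf_2\cdots S_d^nf_d$$ converge in $L^2(\mu)$ as $j\to\infty$; that is, there is $g\in L^2(\mu)$ with $$\lim_{j\to\infty}\Bigl\|\frac1{|I_j|}\sum_{n\in I_j}S_1^nf_1\cdots S_d^nf_d-g\Bigr\|_{L^2(\mu)}=0.$$ -/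

import Mathlib

open MeasureTheory Filter Topology
open scoped ENNReal

/-- The function `S ^ n f`, that is `x ↦ f (S ^ n x)`, for an invertible measurable
transformation `S` and an integer `n` (possibly negative; the power is taken in the group of
permutations of `X`). -/
def transPow {X : Type*} [MeasurableSpace X] (S : X ≃ᵐ X) (n : ℤ) (f : X → ℝ) : X → ℝ :=
  fun x => f (((S.toEquiv : Equiv.Perm X) ^ n) x)

/-- The multiple average `(1 / |I|) ∑_{n ∈ I} S₁ ^ n f₁ ⋯ S_d ^ n f_d`. -/
noncomputable def multipleAverage {X : Type*} [MeasurableSpace X] {d : ℕ}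
    (S : Fin d → X ≃ᵐ X) (f : Fin d → X → ℝ) (I : Finset ℤ) : X → ℝ :=
  fun x => (1 / (I.card : ℝ)) * ∑ n ∈ I, ∏ i, transPow (S i) n (f i) x

/-- A sequence of functions converges in `L²(μ)` (to some element of `L²(μ)`). -/
def ConvergesInL2 {X : Type*} [MeasurableSpace X] (μ : Measure X) (F : ℕ → X → ℝ) : Prop :=
  (∀ j, MemLp (F j) 2 μ) ∧
    ∃ g : X → ℝ, MemLp g 2 μ ∧ Tendsto (fun j => eLpNorm (F j - g) 2 μ) atTop (𝓝 0)

/-!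
For `d ≥ 1`, the average of `S₁ⁿ f₁ ⋯ S_dⁿ f_d` over `I` is the value at `f₁` of a bounded
operator `A_I` on `L²` that depends on `f₂, …, f_d`. A vector `u` orthogonal to all weak limits of
the dual functions `A_I* A_I b`, with `b` bounded, satisfies `‖A_I u‖ → 0`, so convergence has to
be checked only for `u` equal to such a weak limit. The sets `I` are asymptotically invariant under
translation, and a shift of the summation variable then writes `A_J u` as the image, under a bounded
operator that does not depend on `J`, of an average over `J` of only `d - 1` factors. These factors
are bounded families `m ↦ F m` of functions, with the limit of the averages over `m` of `∫ F m` in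
place of the integral. This leads out of the class of probability spaces, but not out of the class
of commutative algebras with an invariant positive functional, on which one inducts on `d`.
-/

open scoped BoundedContinuousFunction

section FinsetAverage

open Finset

variable {α β E F : Type*} [NormedAddCommGroup E] [NormedSpace ℝ E]
  [NormedAddCommGroup F] [NormedSpace ℝ F]

/-- The average over a finite set of indices, as a linear map on families of vectors. The average
over the empty set is `0`. -/
noncomputable def finsetAverage (s : Finset α) : (α → E) →ₗ[ℝ] E :=
  (#s : ℝ)⁻¹ • ∑ n ∈ s, LinearMap.proj n

theorem finsetAverage_apply (s : Finset α) (c : α → E) :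
    finsetAverage s c = (#s : ℝ)⁻¹ • ∑ n ∈ s, c n := by
  simp [finsetAverage]

theorem finsetAverage_const {s : Finset α} (hs : s.Nonempty) (v : E) :
    finsetAverage s (fun _ => v) = v := by
  have : (#s : ℝ) ≠ 0 := by exact_mod_cast hs.card_ne_zero
  rw [finsetAverage_apply, sum_const, ← Nat.cast_smul_eq_nsmul ℝ, inv_smul_smul₀ this]

theorem finsetAverage_mono (s : Finset α) {c c' : α → ℝ} (h : ∀ n, c n ≤ c' n) :
    finsetAverage s c ≤ finsetAverage s c' := by
  simp only [finsetAverage_apply, smul_eq_mul]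
  gcongr
  exact h _

theorem finsetAverage_const_le (s : Finset α) {C : ℝ} (hC : 0 ≤ C) :
    finsetAverage s (fun _ => C) ≤ C := by
  rcases s.eq_empty_or_nonempty with rfl | hs
  · simpa [finsetAverage_apply] using hC
  · exact (finsetAverage_const hs C).le

theorem norm_finsetAverage_le (s : Finset α) (c : α → E) :
    ‖finsetAverage s c‖ ≤ finsetAverage s fun n => ‖c n‖ := by
  rw [finsetAverage_apply, finsetAverage_apply, norm_smul, norm_inv, Real.norm_natCast,
    smul_eq_mul]
  gcongr
  exact norm_sum_le _ _

theorem norm_finsetAverage_le_of_norm_le (s : Finset α) {c : α → E} {C : ℝ} (hC : 0 ≤ C)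
    (h : ∀ n, ‖c n‖ ≤ C) : ‖finsetAverage s c‖ ≤ C :=
  (norm_finsetAverage_le s c).trans ((finsetAverage_mono s h).trans (finsetAverage_const_le s hC))

theorem map_finsetAverage {𝓕 : Type*} [FunLike 𝓕 E F] [LinearMapClass 𝓕 ℝ E F] (f : 𝓕)
    (s : Finset α) (c : α → E) :
    f (finsetAverage s c) = finsetAverage s fun n => f (c n) := by
  simp only [finsetAverage_apply, map_smul, map_sum]

theorem finsetAverage_comm (s : Finset α) (t : Finset β) (c : α → β → E) :
    (finsetAverage s fun n => finsetAverage t (c n)) =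
      finsetAverage t fun m => finsetAverage s fun n => c n m := by
  simp only [finsetAverage_apply, ← smul_sum]
  rw [smul_comm, sum_comm]

theorem sq_finsetAverage_le (s : Finset α) (c : α → ℝ) :
    finsetAverage s c ^ 2 ≤ finsetAverage s fun n => c n ^ 2 := by
  simpa only [finsetAverage_apply, smul_eq_mul, inv_mul_eq_div] using
    sum_div_card_sq_le_sum_sq_div_card

theorem tendsto_finsetAverage_family {ι : Type*} {l : Filter ι} (s : Finset α) {c : ι → α → E}
    {v : α → E} (h : ∀ n, Tendsto (fun j => c j n) l (𝓝 (v n))) :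
    Tendsto (fun j => finsetAverage s (c j)) l (𝓝 (finsetAverage s v)) := by
  simp only [finsetAverage_apply]
  exact (tendsto_finsetSum s fun n _ => h n).const_smul _

end FinsetAverage

section Foelner

open Finset
open scoped symmDiff Pointwise

variable {ι Γ E : Type*} [AddGroup Γ] [NormedAddCommGroup E] [NormedSpace ℝ E]

theorem norm_finsetAverage_sub_shift_le [DecidableEq Γ] (s : Finset Γ) {c : Γ → E} {C : ℝ}
    (hc : ∀ n, ‖c n‖ ≤ C) (g : Γ) :
    ‖finsetAverage s c - finsetAverage s (fun n => c (g + n))‖ ≤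
      C * (#((g +ᵥ s) ∆ s) / #s) := by
  have hshift : ∑ n ∈ s, c (g + n) = ∑ n ∈ g +ᵥ s, c n := by
    simp only [← image_vadd, vadd_eq_add, sum_image fun _ _ _ _ h => add_left_cancel h]
  have hsum (t : Finset Γ) : ‖∑ n ∈ t, c n‖ ≤ #t * C := by
    rw [← nsmul_eq_mul]
    exact norm_sum_le_of_le t (fun n _ => hc n) |>.trans_eq (sum_const C)
  rw [finsetAverage_apply, finsetAverage_apply, ← smul_sub, norm_smul, norm_inv, Real.norm_natCast]
  calc (#s : ℝ)⁻¹ * ‖∑ n ∈ s, c n - ∑ n ∈ s, c (g + n)‖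
      = (#s : ℝ)⁻¹ * ‖∑ n ∈ s \ (g +ᵥ s), c n - ∑ n ∈ (g +ᵥ s) \ s, c n‖ := by
        rw [hshift, sum_sdiff_sub_sum_sdiff]
    _ ≤ (#s : ℝ)⁻¹ * (#(s \ (g +ᵥ s)) * C + #((g +ᵥ s) \ s) * C) := by
        gcongr
        exact norm_sub_le_of_le (hsum _) (hsum _)
    _ = C * (#((g +ᵥ s) ∆ s) / #s) := by
        rw [symmDiff_def, sup_eq_union, card_union_of_disjoint disjoint_sdiff_sdiff]
        push_cast
        ring

variable [MeasurableSpace Γ] [MeasurableSingletonClass Γ] {l : Filter ι} {I : ι → Finset Γ}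

theorem isAddFoelner_count_iff [DecidableEq Γ] :
    IsAddFoelner Γ Measure.count l (fun j => (I j : Set Γ)) ↔
      (∀ᶠ j in l, (I j).Nonempty) ∧
        ∀ g : Γ, Tendsto (fun j => (#((g +ᵥ I j) ∆ I j) : ℝ) / #(I j)) l (𝓝 0) := by
  have hratio (g : Γ) (j : ι) : Measure.count ((g +ᵥ (I j : Set Γ)) ∆ (I j : Set Γ)) /
      Measure.count (I j : Set Γ) = (#((g +ᵥ I j) ∆ I j) : ℝ≥0∞) / #(I j) := by
    rw [← coe_vadd_finset, ← coe_symmDiff, Measure.count_apply_finset, Measure.count_apply_finset]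
  have hfinite (g : Γ) (j : ι) : (#((g +ᵥ I j) ∆ I j) : ℝ≥0∞) / #(I j) ≠ ∞ := by
    rcases (I j).eq_empty_or_nonempty with h | h
    · simp [h]
    · exact ENNReal.div_ne_top (by simp) (by simpa using h.ne_empty)
  simp only [isAddFoelner_iff, hratio, ← ENNReal.tendsto_toReal_zero_iff (hfinite _)]
  simp only [ENNReal.toReal_div, ENNReal.toReal_natCast, Measure.count_apply_finset,
    Finset.measurableSet, eventually_true, ne_eq, ENNReal.natCast_ne_top, not_false_eq_true,
    true_and, Nat.cast_eq_zero, card_eq_zero, nonempty_iff_ne_empty]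

theorem tendsto_finsetAverage_sub_shift
    (hI : IsAddFoelner Γ Measure.count l fun j => (I j : Set Γ)) {c : ι → Γ → E} {C : ℝ}
    (hc : ∀ j n, ‖c j n‖ ≤ C) (g : Γ) :
    Tendsto (fun j => finsetAverage (I j) (c j) - finsetAverage (I j) fun n => c j (g + n))
      l (𝓝 0) := by
  classical
  refine squeeze_zero_norm (fun j => norm_finsetAverage_sub_shift_le (I j) (hc j) g) ?_
  simpa using ((isAddFoelner_count_iff.mp hI).2 g).const_mul C

theorem card_vadd_symmDiff_le {s : Finset ℤ} (hs : (s : Set ℤ).OrdConnected) (g : ℤ) :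
    #((g +ᵥ s) ∆ s) ≤ 2 * g.natAbs := by
  rcases s.eq_empty_or_nonempty with rfl | hne
  · simp
  have hIcc : s = Icc (s.min' hne) (s.max' hne) := Subset.antisymm
    (fun n hn => mem_Icc.mpr ⟨s.min'_le n hn, s.le_max' n hn⟩)
    (fun n hn => hs.out (s.min'_mem hne) (s.max'_mem hne) (mem_Icc.mp hn))
  generalize s.min' hne = a at hIcc
  generalize s.max' hne = b at hIcc
  subst hIcc
  have hsub : (g +ᵥ Icc a b) \ Icc a b ⊆ Ioc b (b + g) ∪ Ico (a + g) a := fun n hn => by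
    obtain ⟨hn, hn'⟩ := Finset.mem_sdiff.mp hn
    obtain ⟨m, hm, rfl⟩ := mem_vadd_finset.mp hn
    simp only [mem_union, mem_Icc, mem_Ioc, mem_Ico, vadd_eq_add] at hm hn' ⊢
    lia
  have hle : #((g +ᵥ Icc a b) \ Icc a b) ≤ g.natAbs := by
    refine (card_le_card hsub).trans ((card_union_le _ _).trans ?_)
    rw [Int.card_Ioc, Int.card_Ico]
    lia
  rw [symmDiff_def, sup_eq_union, card_union_of_disjoint disjoint_sdiff_sdiff, two_mul]
  exact add_le_add hle ((card_sdiff_comm (card_vadd_finset g _)).symm.trans_le hle)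

theorem isAddFoelner_of_ordConnected {I : ι → Finset ℤ}
    (hI : ∀ j, (I j : Set ℤ).OrdConnected) (hcard : Tendsto (fun j => #(I j)) l atTop) :
    IsAddFoelner ℤ Measure.count l fun j => (I j : Set ℤ) := by
  refine isAddFoelner_count_iff.mpr
    ⟨(hcard.eventually_ge_atTop 1).mono fun j hj => card_pos.mp hj, fun g => ?_⟩
  refine squeeze_zero (fun j => by positivity) (fun j => ?_)
    ((tendsto_natCast_atTop_atTop.comp hcard).const_div_atTop (2 * g.natAbs : ℝ))
  simp only [Function.comp_apply]
  gcongr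
  exact_mod_cast card_vadd_symmDiff_le (hI j) g

end Foelner

theorem tendsto_limUnder_of_norm_le {ι E : Type*} [NormedAddCommGroup E] [ProperSpace E]
    (𝒰 : Ultrafilter ι) {x : ι → E} {C : ℝ} (hx : ∀ j, ‖x j‖ ≤ C) :
    Tendsto x 𝒰 (𝓝 (limUnder 𝒰 x)) := by
  have hmem : ↑(𝒰.map x) ≤ 𝓟 (Metric.closedBall (0 : E) C) :=
    tendsto_principal.mpr (Eventually.of_forall fun j => mem_closedBall_zero_iff.mpr (hx j))
  obtain ⟨y, -, hy⟩ := isCompact_iff_ultrafilter_le_nhds.mp (isCompact_closedBall 0 C) _ hmem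
  exact tendsto_nhds_limUnder ⟨y, hy⟩

section WeakConvergence

variable {ι H H' : Type*} [NormedAddCommGroup H] [InnerProductSpace ℝ H]
  [NormedAddCommGroup H'] [InnerProductSpace ℝ H']

/-- Weak convergence of a family of vectors of a real inner product space along a filter. -/
def WeakTendsto (x : ι → H) (l : Filter ι) (y : H) : Prop :=
  ∀ v, Tendsto (fun j => inner ℝ (x j) v) l (𝓝 (inner ℝ y v))

namespace WeakTendsto

variable {l : Filter ι} {x x' : ι → H} {y y' : H}

theorem unique [NeBot l] (h : WeakTendsto x l y) (h' : WeakTendsto x l y') : y = y' :=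
  ext_inner_right ℝ fun v => tendsto_nhds_unique (h v) (h' v)

theorem add (h : WeakTendsto x l y) (h' : WeakTendsto x' l y') :
    WeakTendsto (fun j => x j + x' j) l (y + y') := fun v => by
  simpa only [inner_add_left] using (h v).add (h' v)

theorem const_smul (r : ℝ) (h : WeakTendsto x l y) :
    WeakTendsto (fun j => r • x j) l (r • y) := fun v => by
  simpa only [real_inner_smul_left] using (h v).const_mul r

theorem map [CompleteSpace H] [CompleteSpace H'] (A : H →L[ℝ] H') (h : WeakTendsto x l y) :
    WeakTendsto (fun j => A (x j)) l (A y) := fun v => by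
  simpa only [ContinuousLinearMap.adjoint_inner_right] using h (ContinuousLinearMap.adjoint A v)

theorem of_tendsto_sub (h : WeakTendsto x l y) (hx : Tendsto (fun j => x' j - x j) l (𝓝 0)) :
    WeakTendsto x' l y := fun v => by
  simpa [inner_sub_left] using (hx.inner (tendsto_const_nhds (x := v))).add (h v)

theorem norm_le [NeBot l] (h : WeakTendsto x l y) {c : ι → ℝ} {C : ℝ} (hx : ∀ j, ‖x j‖ ≤ c j)
    (hc : Tendsto c l (𝓝 C)) : ‖y‖ ≤ C := by
  have hC : 0 ≤ C := ge_of_tendsto' hc fun j => (norm_nonneg _).trans (hx j)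
  have hsq : ‖y‖ * ‖y‖ ≤ C * ‖y‖ := by
    rw [← real_inner_self_eq_norm_mul_norm]
    exact le_of_tendsto_of_tendsto' (h y) (hc.mul_const _) fun j =>
      (real_inner_le_norm _ _).trans (by gcongr; exact hx j)
  rcases (norm_nonneg y).eq_or_lt with h0 | h0
  · exact h0 ▸ hC
  · exact le_of_mul_le_mul_right hsq h0

end WeakTendsto

theorem exists_weakTendsto [CompleteSpace H] (𝒰 : Ultrafilter ι) {x : ι → H} {C : ℝ}
    (hx : ∀ j, ‖x j‖ ≤ C) : ∃ y, WeakTendsto x 𝒰 y := by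
  let φ (j : ι) : WeakDual ℝ H := StrongDual.toWeakDual (InnerProductSpace.toDual ℝ H (x j))
  have hφ : Set.range φ ⊆ WeakDual.toStrongDual ⁻¹' Metric.closedBall 0 C := by
    rintro _ ⟨j, rfl⟩
    simpa [φ] using hx j
  obtain ⟨ψ, -, hψ⟩ := isCompact_iff_ultrafilter_le_nhds.mp (WeakDual.isCompact_closedBall 0 C)
    (𝒰.map φ) (le_principal_iff.mpr (mem_of_superset range_mem_map hφ))
  refine ⟨(InnerProductSpace.toDual ℝ H).symm (WeakDual.toStrongDual ψ), fun v => ?_⟩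
  rw [InnerProductSpace.toDual_symm_apply]
  exact ((WeakDual.eval_continuous v).tendsto ψ).comp hψ

theorem exists_continuousLinearMap_weakTendsto [CompleteSpace H] {V W : Type*} [AddCommGroup V]
    [Module ℝ V] [NormedAddCommGroup W] [NormedSpace ℝ W] (𝒰 : Ultrafilter ι) {T : V →ₗ[ℝ] W}
    (hT : DenseRange T) {L : ι → V →ₗ[ℝ] H} {c : ι → V → ℝ} (hLc : ∀ j v, ‖L j v‖ ≤ c j v)
    {C : V → ℝ} (hc : ∀ j v, c j v ≤ C v) {D : ℝ}
    (hlim : ∀ v, Tendsto (fun j => c j v) 𝒰 (𝓝 (D * ‖T v‖))) :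
    ∃ P : W →L[ℝ] H, ∀ v, WeakTendsto (fun j => L j v) 𝒰 (P (T v)) := by
  choose q hq using fun v => exists_weakTendsto 𝒰 fun j => (hLc j v).trans (hc j v)
  let Q : V →ₗ[ℝ] H :=
    { toFun := q
      map_add' := fun v w =>
        (hq (v + w)).unique (by simpa only [map_add] using (hq v).add (hq w))
      map_smul' := fun r v =>
        (hq (r • v)).unique (by simpa only [map_smul] using! (hq v).const_smul r) }
  have hQ (v : V) : ‖Q v‖ ≤ D * ‖T v‖ := (hq v).norm_le (fun j => hLc j v) (hlim v)
  refine ⟨Q.extendOfNorm T, fun v => ?_⟩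
  rw [LinearMap.extendOfNorm_eq hT ⟨D, hQ⟩]
  exact hq v

end WeakConvergence

section Convergence

variable {ι H E : Type*} [NormedAddCommGroup H] [NormedSpace ℝ H]
  [NormedAddCommGroup E] [NormedSpace ℝ E] {l : Filter ι} {C : ℝ}

theorem isClosed_setOf_tendsto_zero {A : ι → H →L[ℝ] E}
    (hA : ∀ i, ‖A i‖ ≤ C) : IsClosed {v | Tendsto (fun i => A i v) l (𝓝 0)} := by
  have hlip (i : ι) : LipschitzWith C.toNNReal (A i) :=
    (A i).lipschitz.weaken (NNReal.coe_le_coe.mp ((hA i).trans (Real.le_coe_toNNReal C)))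
  exact (LipschitzWith.uniformEquicontinuous _ _ hlip).equicontinuous.isClosed_setOfPred_tendsto
    continuous_const

/-- The subspace of vectors along which a family of operators converges in norm. -/
def convergenceSubmodule (A : ι → H →L[ℝ] E) (l : Filter ι) :
    Submodule ℝ H where
  carrier := {v | ∃ z, Tendsto (fun i => A i v) l (𝓝 z)}
  zero_mem' := ⟨0, by simp only [map_zero, tendsto_const_nhds]⟩
  add_mem' := fun ⟨z, hz⟩ ⟨z', hz'⟩ => ⟨z + z', by simpa only [map_add] using hz.add hz'⟩
  smul_mem' := fun r _ ⟨z, hz⟩ => ⟨r • z, by simpa only [map_smul] using hz.const_smul r⟩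

theorem isClosed_convergenceSubmodule [CompleteSpace E] [NeBot l]
    {A : ι → H →L[ℝ] E} (hA : ∀ i, ‖A i‖ ≤ C) :
    IsClosed (convergenceSubmodule A l : Set H) := by
  have heq : (convergenceSubmodule A l : Set H) =
      {v | Tendsto (fun p : ι × ι => (A p.2 - A p.1) v) (l ×ˢ l) (𝓝 0)} := by
    ext v
    change (∃ z, Tendsto (fun i => A i v) l (𝓝 z)) ↔ _
    rw [← cauchy_map_iff_exists_tendsto, cauchy_map_iff', uniformity_eq_comap_nhds_zero,
      tendsto_comap_iff]
    rfl
  rw [heq]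
  exact isClosed_setOf_tendsto_zero fun p => norm_sub_le_of_le (hA p.2) (hA p.1)

end Convergence

theorem exists_tendsto_of_weakTendsto_adjoint {ι H E : Type*} [NormedAddCommGroup H]
    [InnerProductSpace ℝ H] [CompleteSpace H] [NormedAddCommGroup E] [InnerProductSpace ℝ E]
    [CompleteSpace E] {l : Filter ι} [NeBot l] {A : ι → H →L[ℝ] E} {C : ℝ}
    (hA : ∀ i, ‖A i‖ ≤ C) {D : Set H} (hD : Dense D)
    (hdual : ∀ w ∈ D, ∀ 𝒰 : Ultrafilter ι, ↑𝒰 ≤ l → ∀ y,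
      WeakTendsto (fun i => (A i).adjoint (A i w)) 𝒰 y → ∃ z, Tendsto (fun i => A i y) l (𝓝 z))
    (v : H) : ∃ z, Tendsto (fun i => A i v) l (𝓝 z) := by
  set K := convergenceSubmodule A l
  have : CompleteSpace K := (isClosed_convergenceSubmodule hA).completeSpace_coe
  have hadj (x : H) (i : ι) : ‖(A i).adjoint (A i x)‖ ≤ C * (C * ‖x‖) :=
    ContinuousLinearMap.le_of_opNorm_le_of_le _ (by simpa using hA i)
      (ContinuousLinearMap.le_of_opNorm_le _ (hA i) x)
  suffices hK : Kᗮ = ⊥ by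
    have hv : v ∈ K := (Submodule.orthogonal_eq_bot_iff.mp hK) ▸ Submodule.mem_top
    exact hv
  refine (Submodule.eq_bot_iff _).mpr fun u hu => ?_
  have hdense : ∀ w ∈ D, Tendsto (fun i => inner ℝ ((A i).adjoint (A i u)) w) l (𝓝 0) := by
    refine fun w hw => (tendsto_iff_ultrafilter _ _ _).mpr fun 𝒰 h𝒰 => ?_
    obtain ⟨y, hy⟩ := exists_weakTendsto 𝒰 (hadj w)
    have hyu : inner ℝ y u = 0 := hu y (hdual w hw 𝒰 h𝒰 y hy)
    simpa only [ContinuousLinearMap.adjoint_inner_left, real_inner_comm, hyu] using hy u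
  have hclosed := isClosed_setOf_tendsto_zero (l := l)
    (A := fun i => innerSL ℝ ((A i).adjoint (A i u))) fun i => by simpa using hadj u i
  have huu : Tendsto (fun i => inner ℝ ((A i).adjoint (A i u)) u) l (𝓝 0) :=
    hclosed.closure_subset_iff.mpr hdense (hD u)
  have hu0 : Tendsto (fun i => A i u) l (𝓝 0) := by
    simp only [ContinuousLinearMap.adjoint_inner_left, real_inner_self_eq_norm_sq] at huu
    simpa [tendsto_zero_iff_norm_tendsto_zero] using huu.sqrt
  exact Submodule.inf_orthogonal_eq_bot K |>.le ⟨⟨0, hu0⟩, hu⟩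

/-- A positive functional on a commutative normed algebra, together with an action of a group by
contractive algebra endomorphisms that preserve the functional. It plays the role of integration
over a measure-preserving system, whose bounded functions form the algebra. -/
structure InvariantState (G R : Type*) [CommGroup G] [NormedCommRing R] [NormedAlgebra ℝ R] where
  state : R →ₗ[ℝ] ℝ
  act : G →* (R →ₐ[ℝ] R)
  state_mul_self_nonneg : ∀ a, 0 ≤ state (a * a)
  state_mul_le : ∀ a b, state (a * b * (a * b)) ≤ ‖a‖ ^ 2 * state (b * b)
  state_act : ∀ g a, state (act g a) = state a
  norm_act_le : ∀ g a, ‖act g a‖ ≤ ‖a‖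

namespace InvariantState

section L2

variable {G R : Type*} [CommGroup G] [NormedCommRing R] [NormedAlgebra ℝ R]

/-- The algebra `R` as a pre-inner product space with `⟪a, b⟫ = σ (a * b)`. -/
def PreL2 (_ : InvariantState G R) := R

variable (σ : InvariantState G R)

noncomputable instance : AddCommGroup σ.PreL2 := inferInstanceAs (AddCommGroup R)

noncomputable instance : Module ℝ σ.PreL2 := inferInstanceAs (Module ℝ R)

/-- The identity map from `R` to `σ.PreL2`. -/
noncomputable def toPreL2 : R ≃ₗ[ℝ] σ.PreL2 := LinearEquiv.refl ℝ _

/-- The pre-inner product `⟪a, b⟫ = σ (a * b)`. -/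
noncomputable abbrev preL2Core : PreInnerProductSpace.Core ℝ σ.PreL2 where
  inner a b := σ.state (σ.toPreL2.symm a * σ.toPreL2.symm b)
  conj_inner_symm a b := by simp [mul_comm]
  re_inner_nonneg a := by simpa using σ.state_mul_self_nonneg _
  add_left a b c := by rw [map_add, add_mul, map_add]
  smul_left a b r := by simp

noncomputable instance : SeminormedAddCommGroup σ.PreL2 :=
  InnerProductSpace.Core.toSeminormedAddCommGroup (c := σ.preL2Core)

noncomputable instance : InnerProductSpace ℝ σ.PreL2 :=
  InnerProductSpace.ofCore σ.preL2Core

/-- The Hilbert space of an invariant state (the Gelfand–Naimark–Segal construction). -/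
abbrev L2 := UniformSpace.Completion σ.PreL2

/-- The canonical map from the algebra to the Hilbert space of the state. -/
noncomputable def toL2 : R →ₗ[ℝ] σ.L2 :=
  (UniformSpace.Completion.toComplL : σ.PreL2 →L[ℝ] σ.L2).toLinearMap ∘ₗ σ.toPreL2.toLinearMap

theorem inner_toL2 (a b : R) : inner ℝ (σ.toL2 a) (σ.toL2 b) = σ.state (a * b) :=
  UniformSpace.Completion.inner_coe (𝕜 := ℝ) (σ.toPreL2 a) (σ.toPreL2 b)

theorem norm_toL2_sq (a : R) : ‖σ.toL2 a‖ ^ 2 = σ.state (a * a) := by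
  rw [← inner_toL2, real_inner_self_eq_norm_sq]

theorem norm_toL2 (a : R) : ‖σ.toL2 a‖ = √(σ.state (a * a)) := by
  rw [← norm_toL2_sq, Real.sqrt_sq (norm_nonneg _)]

theorem denseRange_toL2 : DenseRange σ.toL2 := by
  have h : DenseRange (UniformSpace.Completion.coe' : σ.PreL2 → σ.L2) :=
    UniformSpace.Completion.denseRange_coe
  exact h.comp σ.toPreL2.surjective.denseRange (UniformSpace.Completion.continuous_coe _)

theorem norm_toL2_mul_le (a b : R) : ‖σ.toL2 (a * b)‖ ≤ ‖a‖ * ‖σ.toL2 b‖ := by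
  rw [← sq_le_sq₀ (by positivity) (by positivity), mul_pow, norm_toL2_sq, norm_toL2_sq]
  exact σ.state_mul_le a b

theorem norm_toL2_le (a : R) : ‖σ.toL2 a‖ ≤ ‖a‖ * ‖σ.toL2 1‖ := by
  simpa only [mul_one] using σ.norm_toL2_mul_le a 1

theorem norm_toL2_act (g : G) (a : R) : ‖σ.toL2 (σ.act g a)‖ = ‖σ.toL2 a‖ := by
  rw [norm_toL2, norm_toL2, ← map_mul, σ.state_act]

theorem norm_state_le (a : R) : ‖σ.state a‖ ≤ ‖a‖ * ‖σ.toL2 1‖ * ‖σ.toL2 1‖ := by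
  rw [← mul_one a, ← inner_toL2]
  refine (norm_inner_le_norm _ _).trans ?_
  gcongr
  exact (mul_one a).symm ▸ σ.norm_toL2_le a

theorem act_act (g h : G) (a : R) : σ.act g (σ.act h a) = σ.act (g * h) a := by
  rw [map_mul, AlgHom.mul_apply]

end L2

section Orbit

variable {G R : Type*} [CommGroup G] [NormedCommRing R] [NormedAlgebra ℝ R]
  (σ : InvariantState G R)

/-- The bounded family `n ↦ s ^ n • a`. -/
noncomputable def orbit (s : G) (a : R) : ℤ →ᵇ R :=
  BoundedContinuousFunction.ofNormedAddCommGroupDiscrete (fun n => σ.act (s ^ n) a) ‖a‖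
    fun _ => σ.norm_act_le _ _

theorem orbit_apply (s : G) (a : R) (n : ℤ) : σ.orbit s a n = σ.act (s ^ n) a := rfl

/-- The bounded family `n ↦ ∏ i, s i ^ n • a i`. -/
noncomputable def prodOrbit {d : ℕ} (s : Fin d → G) (a : Fin d → R) : ℤ →ᵇ R :=
  ∏ i, σ.orbit (s i) (a i)

theorem prodOrbit_apply {d : ℕ} (s : Fin d → G) (a : Fin d → R) (n : ℤ) :
    σ.prodOrbit s a n = ∏ i, σ.act (s i ^ n) (a i) := by
  simp only [prodOrbit, BoundedContinuousFunction.coe_prod, Finset.prod_apply, orbit_apply]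

end Orbit

section Twisted

variable {G R : Type*} [CommGroup G] [NormedCommRing R] [NormedAlgebra ℝ R]
  (σ : InvariantState G R) (t : G) (τ : ℤ →ᵇ R) (I : Finset ℤ)

/-- The operator that averages `b ↦ τ n * (t ^ n • b)` over `n ∈ I`. It expresses how a multiple
average depends on one of its functions, `τ n` being the product of the other factors. -/
noncomputable def twistedAvg : R →ₗ[ℝ] R :=
  finsetAverage I ∘ₗ LinearMap.pi fun n =>
    LinearMap.mulLeft ℝ (τ n) ∘ₗ (σ.act (t ^ n)).toLinearMap

theorem twistedAvg_apply (b : R) :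
    σ.twistedAvg t τ I b = finsetAverage I fun n => τ n * σ.act (t ^ n) b := rfl

theorem norm_twistedAvg_le (b : R) : ‖σ.twistedAvg t τ I b‖ ≤ ‖τ‖ * ‖b‖ :=
  norm_finsetAverage_le_of_norm_le I (by positivity) fun n =>
    norm_mul_le_of_le (τ.norm_coe_le_norm n) (σ.norm_act_le _ b)

theorem norm_toL2_twistedAvg_le (b : R) : ‖σ.toL2 (σ.twistedAvg t τ I b)‖ ≤ ‖τ‖ * ‖σ.toL2 b‖ := by
  rw [twistedAvg_apply, map_finsetAverage]
  refine norm_finsetAverage_le_of_norm_le I (by positivity) fun n => ?_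
  refine (σ.norm_toL2_mul_le _ _).trans ?_
  rw [norm_toL2_act]
  gcongr
  exact τ.norm_coe_le_norm n

/-- The formal adjoint of `twistedAvg`, which averages `h ↦ t ^ (-n) • (h * τ n)` over `n ∈ I`. -/
noncomputable def twistedDual (h : R) : R :=
  finsetAverage I fun n => σ.act (t ^ (-n)) (h * τ n)

theorem state_twistedDual_mul (h b : R) :
    σ.state (σ.twistedDual t τ I h * b) = σ.state (h * σ.twistedAvg t τ I b) := by
  have hterm (n : ℤ) :
      σ.state (σ.act (t ^ (-n)) (h * τ n) * b) = σ.state (h * (τ n * σ.act (t ^ n) b)) := by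
    rw [← σ.state_act (t ^ n), map_mul, act_act, ← zpow_add, add_neg_cancel, zpow_zero, map_one,
      AlgHom.one_apply, mul_assoc]
  have hleft := map_finsetAverage (σ.state ∘ₗ LinearMap.mulRight ℝ b) I
    fun n => σ.act (t ^ (-n)) (h * τ n)
  have hright := map_finsetAverage (σ.state ∘ₗ LinearMap.mulLeft ℝ h) I
    fun n => τ n * σ.act (t ^ n) b
  simp only [LinearMap.comp_apply, LinearMap.mulLeft_apply, LinearMap.mulRight_apply]
    at hleft hright
  rw [twistedDual, twistedAvg_apply, hleft, hright]
  simp only [hterm]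

/-- The extension of `twistedAvg` to the Hilbert space of the state. -/
noncomputable def twistedAvgL2 : σ.L2 →L[ℝ] σ.L2 :=
  (σ.toL2 ∘ₗ σ.twistedAvg t τ I).extendOfNorm σ.toL2

theorem twistedAvgL2_toL2 (b : R) :
    σ.twistedAvgL2 t τ I (σ.toL2 b) = σ.toL2 (σ.twistedAvg t τ I b) :=
  LinearMap.extendOfNorm_eq σ.denseRange_toL2 ⟨‖τ‖, σ.norm_toL2_twistedAvg_le t τ I⟩ b

theorem norm_twistedAvgL2_le : ‖σ.twistedAvgL2 t τ I‖ ≤ ‖τ‖ :=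
  LinearMap.opNorm_extendOfNorm_le σ.denseRange_toL2 (norm_nonneg τ)
    (σ.norm_toL2_twistedAvg_le t τ I)

theorem adjoint_twistedAvgL2_toL2 (h : R) :
    (σ.twistedAvgL2 t τ I).adjoint (σ.toL2 h) = σ.toL2 (σ.twistedDual t τ I h) := by
  refine ext_inner_right ℝ fun v => ?_
  induction v using σ.denseRange_toL2.induction_on with
  | hp => exact isClosed_eq (by fun_prop) (by fun_prop)
  | ih b =>
    rw [ContinuousLinearMap.adjoint_inner_left, twistedAvgL2_toL2, inner_toL2, inner_toL2,
      state_twistedDual_mul]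

end Twisted

section Mean

variable {ι G R : Type*} [CommGroup G] [NormedCommRing R] [NormedAlgebra ℝ R]
  (σ : InvariantState G R) (𝒰 : Ultrafilter ι) (I : ι → Finset ℤ)

/-- The action of the group on bounded families of elements of `R`, term by term. -/
noncomputable def familyAct : G →* ((ℤ →ᵇ R) →ₐ[ℝ] (ℤ →ᵇ R)) where
  toFun g := BoundedContinuousFunction.AlgHom.compLeftContinuousBounded ℝ (σ.act g)
    (AddMonoidHomClass.lipschitz_of_bound (σ.act g) 1 fun a => by
      simpa only [one_mul] using σ.norm_act_le g a)
  map_one' := by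
    ext F m
    exact DFunLike.congr_fun (map_one σ.act) (F m)
  map_mul' g g' := by
    ext F m
    exact (σ.act_act g g' (F m)).symm

theorem tendsto_limUnder_avg_state (F : ℤ →ᵇ R) :
    Tendsto (fun j => finsetAverage (I j) fun m => σ.state (F m)) 𝒰
      (𝓝 (limUnder 𝒰 fun j => finsetAverage (I j) fun m => σ.state (F m))) :=
  tendsto_limUnder_of_norm_le (C := ‖F‖ * ‖σ.toL2 1‖ * ‖σ.toL2 1‖) 𝒰 fun j =>
    norm_finsetAverage_le_of_norm_le (I j) (by positivity) fun m =>
      (σ.norm_state_le (F m)).trans (by gcongr; exact F.norm_coe_le_norm m)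

/-- The state on bounded families `F` of elements of `R` whose value is the mean of `σ (F m)` over
`m ∈ I j`, in the limit of `j` along an ultrafilter. -/
noncomputable def meanState : InvariantState G (ℤ →ᵇ R) where
  state :=
    { toFun := fun F => limUnder 𝒰 fun j => finsetAverage (I j) fun m => σ.state (F m)
      map_add' := fun F F' => Tendsto.limUnder_eq <|
        ((σ.tendsto_limUnder_avg_state 𝒰 I F).add (σ.tendsto_limUnder_avg_state 𝒰 I F')).congr
          fun j => by
            rw [← map_add]
            exact congrArg _ (funext fun m => (map_add σ.state (F m) (F' m)).symm)
      map_smul' := fun r F => Tendsto.limUnder_eq <|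
        ((σ.tendsto_limUnder_avg_state 𝒰 I F).const_smul r).congr fun j => by
          rw [← map_smul]
          exact congrArg _ (funext fun m => (map_smul σ.state r (F m)).symm) }
  act := σ.familyAct
  state_mul_self_nonneg F :=
    ge_of_tendsto' (σ.tendsto_limUnder_avg_state 𝒰 I (F * F)) fun j =>
      (map_zero (finsetAverage (I j))).symm.trans_le
        (finsetAverage_mono (I j) fun m => σ.state_mul_self_nonneg (F m))
  state_mul_le F F' := by
    refine le_of_tendsto_of_tendsto' (σ.tendsto_limUnder_avg_state 𝒰 I (F * F' * (F * F')))
      ((σ.tendsto_limUnder_avg_state 𝒰 I (F' * F')).const_smul (‖F‖ ^ 2)) fun j => ?_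
    rw [← map_smul]
    refine finsetAverage_mono (I j) fun m => (σ.state_mul_le (F m) (F' m)).trans ?_
    exact mul_le_mul_of_nonneg_right (pow_le_pow_left₀ (norm_nonneg _) (F.norm_coe_le_norm m) 2)
      (σ.state_mul_self_nonneg _)
  state_act g F := by
    change limUnder 𝒰 (fun j => finsetAverage (I j) fun m => σ.state (σ.act g (F m))) = _
    simp only [σ.state_act]
    rfl
  norm_act_le g F :=
    (BoundedContinuousFunction.norm_le (norm_nonneg F)).mpr fun m =>
      (σ.norm_act_le g (F m)).trans (F.norm_coe_le_norm m)

theorem tendsto_meanState (F : ℤ →ᵇ R) :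
    Tendsto (fun j => finsetAverage (I j) fun m => σ.state (F m)) 𝒰
      (𝓝 ((σ.meanState 𝒰 I).state F)) :=
  σ.tendsto_limUnder_avg_state 𝒰 I F

theorem finsetAverage_prodOrbit_meanState_apply {d : ℕ} (s : Fin d → G) (F : Fin d → ℤ →ᵇ R)
    (J : Finset ℤ) (m : ℤ) :
    finsetAverage J ((σ.meanState 𝒰 I).prodOrbit s F) m =
      finsetAverage J (σ.prodOrbit s fun i => F i m) := by
  refine (map_finsetAverage (BoundedContinuousFunction.evalCLM ℝ m) J _).trans ?_
  congr 1
  ext n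
  simp only [prodOrbit_apply, BoundedContinuousFunction.evalCLM_apply,
    BoundedContinuousFunction.coe_prod, Finset.prod_apply]
  rfl

end Mean

section VanDerCorput

variable {ι G R : Type*} [CommGroup G] [NormedCommRing R] [NormedAlgebra ℝ R]
  (σ : InvariantState G R) {d : ℕ} (s : Fin d → G) (a : Fin d → R) (t : G)

/-- The families `m ↦ a i * ((t⁻¹ * s i) ^ m • a i)` that arise when a shift by `m` is pulled out
of a dual function. -/
noncomputable def crossFamily (i : Fin d) : ℤ →ᵇ R :=
  BoundedContinuousFunction.const ℤ (a i) * σ.orbit (t⁻¹ * s i) (a i)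

theorem act_mul_prodOrbit_crossFamily (h : R) (k m : ℤ) :
    σ.act (t ^ (-m)) h * σ.prodOrbit s (fun i => σ.crossFamily s a t i m) k =
      σ.prodOrbit s a k * σ.act (t ^ (k - (k + m))) (h * σ.prodOrbit s a (k + m)) := by
  have hexp (i : Fin d) : t ^ (-m) * s i ^ (k + m) = s i ^ k * (t⁻¹ * s i) ^ m := by
    rw [mul_zpow, inv_zpow', zpow_add, mul_left_comm]
  have hfactor (i : Fin d) : σ.act (s i ^ k) (σ.crossFamily s a t i m) =
      σ.act (s i ^ k) (a i) * σ.act (t ^ (-m)) (σ.act (s i ^ (k + m)) (a i)) := by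
    rw [act_act, hexp, ← act_act, ← map_mul]
    rfl
  rw [sub_add_cancel_left]
  simp only [prodOrbit_apply, hfactor, Finset.prod_mul_distrib, map_mul, map_prod]
  exact mul_left_comm _ _ _

theorem twistedAvg_twistedDual (τ : ℤ →ᵇ R) (I J : Finset ℤ) (h : R) :
    σ.twistedAvg t τ J (σ.twistedDual t τ I h) = finsetAverage J fun k =>
      finsetAverage I fun n => τ k * σ.act (t ^ (k - n)) (h * τ n) := by
  rw [twistedAvg_apply]
  congr 1
  ext k
  rw [twistedDual, map_finsetAverage, ← LinearMap.mulLeft_apply (R := ℝ), map_finsetAverage]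
  simp only [LinearMap.mulLeft_apply, act_act, ← zpow_add, sub_eq_add_neg]

-- The exponent on the right is left unsimplified, so that the summands are those of
-- `twistedAvg_twistedDual` with `k + m` for `n`.
theorem finsetAverage_act_mul_finsetAverage_crossFamily (I J : Finset ℤ) (h : R) :
    (finsetAverage I fun m => σ.act (t ^ (-m)) h *
        finsetAverage J (σ.prodOrbit s fun i => σ.crossFamily s a t i m)) =
      finsetAverage J fun k => finsetAverage I fun m =>
        σ.prodOrbit s a k * σ.act (t ^ (k - (k + m))) (h * σ.prodOrbit s a (k + m)) := by
  rw [finsetAverage_comm]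
  congr 1
  ext m
  rw [← LinearMap.mulLeft_apply (R := ℝ), map_finsetAverage]
  simp only [LinearMap.mulLeft_apply, act_mul_prodOrbit_crossFamily]

theorem tendsto_twistedAvg_twistedDual_sub {l : Filter ι} {I : ι → Finset ℤ}
    (hI : IsAddFoelner ℤ Measure.count l fun j => (I j : Set ℤ)) {h : ι → R} {D : ℝ}
    (hh : ∀ j, ‖h j‖ ≤ D) (J : Finset ℤ) :
    Tendsto (fun j => σ.twistedAvg t (σ.prodOrbit s a) J
        (σ.twistedDual t (σ.prodOrbit s a) (I j) (h j)) -
      finsetAverage (I j) fun m => σ.act (t ^ (-m)) (h j) *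
        finsetAverage J (σ.prodOrbit s fun i => σ.crossFamily s a t i m)) l (𝓝 0) := by
  set τ := σ.prodOrbit s a
  have hbound (k : ℤ) (j : ι) (n : ℤ) :
      ‖τ k * σ.act (t ^ (k - n)) (h j * τ n)‖ ≤ ‖τ‖ * (D * ‖τ‖) :=
    norm_mul_le_of_le (τ.norm_coe_le_norm k) <| (σ.norm_act_le _ _).trans <|
      norm_mul_le_of_le (hh j) (τ.norm_coe_le_norm n)
  simp only [twistedAvg_twistedDual, finsetAverage_act_mul_finsetAverage_crossFamily, ← map_sub]
  rw [← map_zero (finsetAverage J)]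
  exact tendsto_finsetAverage_family J fun k =>
    tendsto_finsetAverage_sub_shift hI (hbound k) k

theorem norm_toL2_finsetAverage_act_mul_le {D : ℝ} {h : R} (hh : ‖h‖ ≤ D) (F : ℤ → R)
    (I : Finset ℤ) :
    ‖σ.toL2 (finsetAverage I fun m => σ.act (t ^ (-m)) h * F m)‖ ≤
      D * √(finsetAverage I fun m => σ.state (F m * F m)) := by
  have hD := (norm_nonneg h).trans hh
  rw [map_finsetAverage]
  calc _ ≤ finsetAverage I fun m => ‖σ.toL2 (σ.act (t ^ (-m)) h * F m)‖ :=
        norm_finsetAverage_le _ _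
    _ ≤ finsetAverage I fun m => D * ‖σ.toL2 (F m)‖ := finsetAverage_mono I fun m =>
        (σ.norm_toL2_mul_le _ _).trans (by gcongr; exact (σ.norm_act_le _ _).trans hh)
    _ = D * finsetAverage I fun m => ‖σ.toL2 (F m)‖ :=
        map_smul (finsetAverage I) D _
    _ ≤ D * √(finsetAverage I fun m => σ.state (F m * F m)) := by
        gcongr
        simp only [← norm_toL2_sq]
        exact Real.le_sqrt_of_sq_le (sq_finsetAverage_le _ _)

theorem exists_continuousLinearMap_meanState (𝒰 : Ultrafilter ι) (I : ι → Finset ℤ) {h : ι → R}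
    {D : ℝ} (hh : ∀ j, ‖h j‖ ≤ D) :
    ∃ P : (σ.meanState 𝒰 I).L2 →L[ℝ] σ.L2, ∀ F : ℤ →ᵇ R,
      WeakTendsto (fun j => σ.toL2 (finsetAverage (I j) fun m => σ.act (t ^ (-m)) (h j) * F m)) 𝒰
        (P ((σ.meanState 𝒰 I).toL2 F)) := by
  let L (j : ι) : (ℤ →ᵇ R) →ₗ[ℝ] σ.L2 :=
    σ.toL2 ∘ₗ finsetAverage (I j) ∘ₗ LinearMap.pi fun m =>
      LinearMap.mulLeft ℝ (σ.act (t ^ (-m)) (h j)) ∘ₗ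
        (BoundedContinuousFunction.evalCLM ℝ m).toLinearMap
  refine exists_continuousLinearMap_weakTendsto (C := fun F => D * (‖F‖ * ‖σ.toL2 1‖)) (D := D)
    𝒰 (σ.meanState 𝒰 I).denseRange_toL2 (L := L)
    (fun j F => σ.norm_toL2_finsetAverage_act_mul_le t (hh j) F (I j)) (fun j F => ?_)
    fun F => ?_
  · have hD := (norm_nonneg _).trans (hh j)
    gcongr
    refine Real.sqrt_le_iff.mpr ⟨by positivity, ?_⟩
    refine (Real.le_norm_self _).trans
      (norm_finsetAverage_le_of_norm_le (I j) (by positivity) fun m => ?_)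
    rw [← norm_toL2_sq, norm_pow, norm_norm]
    gcongr
    exact (σ.norm_toL2_le (F m)).trans (by gcongr; exact F.norm_coe_le_norm m)
  · rw [norm_toL2]
    exact ((σ.tendsto_meanState 𝒰 I (F * F)).sqrt).const_mul D

end VanDerCorput

section Convergence

theorem continuous_toL2 {G R : Type*} [CommGroup G] [NormedCommRing R] [NormedAlgebra ℝ R]
    (σ : InvariantState G R) : Continuous σ.toL2 :=
  AddMonoidHomClass.continuous_of_bound σ.toL2 ‖σ.toL2 1‖ fun a =>
    (σ.norm_toL2_le a).trans_eq (mul_comm _ _)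

variable {ι G : Type*} [CommGroup G]

theorem prodOrbit_succ {R : Type*} [NormedCommRing R] [NormedAlgebra ℝ R]
    (σ : InvariantState G R) {d : ℕ} (s : Fin (d + 1) → G) (a : Fin (d + 1) → R) :
    σ.prodOrbit s a = σ.orbit (s 0) (a 0) * σ.prodOrbit (Fin.tail s) (Fin.tail a) :=
  Fin.prod_univ_succ _

theorem finsetAverage_prodOrbit_succ {R : Type*} [NormedCommRing R] [NormedAlgebra ℝ R]
    (σ : InvariantState G R) {d : ℕ} (s : Fin (d + 1) → G) (a : Fin (d + 1) → R) (I : Finset ℤ) :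
    finsetAverage I (σ.prodOrbit s a) =
      σ.twistedAvg (s 0) (σ.prodOrbit (Fin.tail s) (Fin.tail a)) I (a 0) := by
  rw [prodOrbit_succ, mul_comm]
  rfl

theorem exists_twistedAvgL2_eq_meanState {R : Type*} [NormedCommRing R] [NormedAlgebra ℝ R]
    (σ : InvariantState G R) {d : ℕ} (s : Fin d → G) (a : Fin d → R) (t : G)
    (𝒰 : Ultrafilter ι) {I : ι → Finset ℤ}
    (hI : IsAddFoelner ℤ Measure.count 𝒰 fun j => (I j : Set ℤ)) {h : ι → R} {D : ℝ}
    (hh : ∀ j, ‖h j‖ ≤ D) {y : σ.L2}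
    (hy : WeakTendsto (fun j => σ.toL2 (σ.twistedDual t (σ.prodOrbit s a) (I j) (h j))) 𝒰 y) :
    ∃ P : (σ.meanState 𝒰 I).L2 →L[ℝ] σ.L2, ∀ J : Finset ℤ,
      σ.twistedAvgL2 t (σ.prodOrbit s a) J y = P ((σ.meanState 𝒰 I).toL2
        (finsetAverage J ((σ.meanState 𝒰 I).prodOrbit s (σ.crossFamily s a t)))) := by
  obtain ⟨P, hP⟩ := σ.exists_continuousLinearMap_meanState t 𝒰 I hh
  refine ⟨P, fun J => (hy.map (σ.twistedAvgL2 t (σ.prodOrbit s a) J)).unique ?_⟩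
  refine (hP _).of_tendsto_sub ?_
  simp only [twistedAvgL2_toL2, finsetAverage_prodOrbit_meanState_apply, ← map_sub]
  rw [← map_zero σ.toL2]
  exact (σ.continuous_toL2.tendsto 0).comp (σ.tendsto_twistedAvg_twistedDual_sub s a t hI hh J)

theorem exists_tendsto_toL2_finsetAverage_prodOrbit {l : Filter ι} [NeBot l] {I : ι → Finset ℤ}
    (hI : IsAddFoelner ℤ Measure.count l fun j => (I j : Set ℤ)) {d : ℕ} :
    ∀ {R : Type*} [NormedCommRing R] [NormedAlgebra ℝ R] (σ : InvariantState G R) (s : Fin d → G)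
      (a : Fin d → R),
      ∃ z, Tendsto (fun j => σ.toL2 (finsetAverage (I j) (σ.prodOrbit s a))) l (𝓝 z) := by
  induction d with
  | zero =>
    intro R _ _ σ s a
    refine ⟨σ.toL2 1, tendsto_const_nhds.congr' ?_⟩
    filter_upwards [(isAddFoelner_count_iff.mp hI).1] with j hj
    exact congrArg σ.toL2 (finsetAverage_const hj 1).symm
  | succ d ih =>
    intro R _ _ σ s a
    set t := s 0
    set τ := σ.prodOrbit (Fin.tail s) (Fin.tail a)
    suffices h : ∃ z, Tendsto (fun j => σ.twistedAvgL2 t τ (I j) (σ.toL2 (a 0))) l (𝓝 z) by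
      simpa only [finsetAverage_prodOrbit_succ, twistedAvgL2_toL2] using h
    refine exists_tendsto_of_weakTendsto_adjoint (fun j => σ.norm_twistedAvgL2_le t τ (I j))
      σ.denseRange_toL2 ?_ _
    rintro _ ⟨b, rfl⟩ 𝒰 h𝒰 y hy
    simp only [twistedAvgL2_toL2, adjoint_twistedAvgL2_toL2] at hy
    obtain ⟨P, hP⟩ := σ.exists_twistedAvgL2_eq_meanState (Fin.tail s) (Fin.tail a) t 𝒰
      (hI.mono h𝒰) (fun j => σ.norm_twistedAvg_le t τ (I j) b) hy
    obtain ⟨z, hz⟩ := ih (σ.meanState 𝒰 I) (Fin.tail s)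
      (σ.crossFamily (Fin.tail s) (Fin.tail a) t)
    exact ⟨P z, ((P.continuous.tendsto z).comp hz).congr fun j => (hP (I j)).symm⟩

end Convergence

end InvariantState

section BoundedMeasurable

variable {X : Type*} [MeasurableSpace X]

/-- The subalgebra of measurable functions in the algebra of all bounded real functions. -/
def measurableSubalgebra (X : Type*) [MeasurableSpace X] :
    Subalgebra ℝ (lp (fun _ : X => ℝ) ∞) where
  carrier := {f | Measurable f}
  mul_mem' hf hg := Measurable.mul hf hg
  add_mem' hf hg := Measurable.add hf hg
  algebraMap_mem' _ := measurable_const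

/-- The algebra of bounded measurable real functions with the supremum norm. -/
def BoundedMeasurable (X : Type*) [MeasurableSpace X] : Type _ := measurableSubalgebra X

namespace BoundedMeasurable

noncomputable instance : NormedCommRing (BoundedMeasurable X) :=
  inferInstanceAs (NormedCommRing (measurableSubalgebra X))

noncomputable instance : NormedAlgebra ℝ (BoundedMeasurable X) :=
  inferInstanceAs (NormedAlgebra ℝ (measurableSubalgebra X))

instance : CoeFun (BoundedMeasurable X) fun _ => X → ℝ := ⟨fun f => f.1⟩

theorem measurable (f : BoundedMeasurable X) : Measurable f := f.2

theorem norm_apply_le (f : BoundedMeasurable X) (x : X) : ‖f x‖ ≤ ‖f‖ :=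
  lp.norm_apply_le_norm ENNReal.top_ne_zero f.1 x

theorem memLp (f : BoundedMeasurable X) (μ : Measure X) [IsFiniteMeasure μ] (p : ℝ≥0∞) :
    MemLp f p μ :=
  MemLp.of_bound f.measurable.aestronglyMeasurable ‖f‖ (Eventually.of_forall f.norm_apply_le)

theorem integrable (f : BoundedMeasurable X) (μ : Measure X) [IsFiniteMeasure μ] :
    Integrable f μ :=
  memLp_one_iff_integrable.mp (f.memLp μ 1)

@[ext]
theorem ext {f g : BoundedMeasurable X} (h : ∀ x, f x = g x) : f = g :=
  Subtype.ext (lp.ext (funext h))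

/-- Evaluation at a point. -/
noncomputable def eval (x : X) : BoundedMeasurable X →ₐ[ℝ] ℝ where
  toFun f := f x
  map_one' := rfl
  map_mul' _ _ := rfl
  map_zero' := rfl
  map_add' _ _ := rfl
  commutes' _ := rfl

/-- Composition with a measurable map. -/
noncomputable def comp (g : X → X) (hg : Measurable g) :
    BoundedMeasurable X →ₐ[ℝ] BoundedMeasurable X where
  toFun f := ⟨⟨f ∘ g, memℓp_infty ⟨‖f‖, Set.forall_mem_range.mpr fun x => f.norm_apply_le (g x)⟩⟩,
    f.measurable.comp hg⟩
  map_one' := rfl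
  map_mul' _ _ := rfl
  map_zero' := rfl
  map_add' _ _ := rfl
  commutes' _ := rfl

theorem exists_ae_eq {μ : Measure X} {f : X → ℝ} (hf : MemLp f ∞ μ) :
    ∃ b : BoundedMeasurable X, f =ᵐ[μ] b := by
  set C := lpNorm f ∞ μ
  obtain ⟨f₀, hf₀, hff₀⟩ := hf.1.aemeasurable
  have hbound (x : X) : ‖max (-C) (min C (f₀ x))‖ ≤ C := by
    have hC : 0 ≤ C := lpNorm_nonneg
    exact abs_le.mpr ⟨le_max_left _ _, max_le (neg_le_self hC) (min_le_left _ _)⟩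
  refine ⟨⟨⟨fun x => max (-C) (min C (f₀ x)),
    memℓp_infty ⟨C, Set.forall_mem_range.mpr hbound⟩⟩,
    measurable_const.max (measurable_const.min hf₀)⟩, ?_⟩
  filter_upwards [hff₀, ae_le_lpNorm_exponent_top hf] with x hx hle
  obtain ⟨hlower, hupper⟩ := abs_le.mp (hx ▸ hle)
  exact hx.trans (by rw [min_eq_right hupper, max_eq_right hlower])

/-- The class of a bounded measurable function in `L²`. -/
noncomputable def toLp (μ : Measure X) [IsFiniteMeasure μ] :
    BoundedMeasurable X →ₗ[ℝ] Lp ℝ 2 μ where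
  toFun f := (f.memLp μ 2).toLp f
  map_add' _ _ := rfl
  map_smul' _ _ := rfl

theorem norm_toLp_sq (μ : Measure X) [IsFiniteMeasure μ] (f : BoundedMeasurable X) :
    ‖toLp μ f‖ ^ 2 = ∫ x, (f * f) x ∂μ := by
  rw [← real_inner_self_eq_norm_sq, L2.inner_def]
  refine integral_congr_ae ?_
  filter_upwards [(f.memLp μ 2).coeFn_toLp] with x hx
  change inner ℝ (((f.memLp μ 2).toLp f) x) (((f.memLp μ 2).toLp f) x) = f x * f x
  rw [hx]
  rfl

end BoundedMeasurable

end BoundedMeasurable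

namespace InvariantState

variable {X G : Type*} [MeasurableSpace X] [CommGroup G] [MulAction G X] [MeasurableConstSMul G X]

section OfMeasure

variable (G) (μ : Measure X) [IsFiniteMeasure μ] [SMulInvariantMeasure G X μ]

/-- Integration of bounded measurable functions on a measure-preserving system. -/
noncomputable def ofMeasure : InvariantState G (BoundedMeasurable X) where
  state :=
    { toFun := fun f => ∫ x, f x ∂μ
      map_add' := fun f g => integral_add (f.integrable μ) (g.integrable μ)
      map_smul' := fun r f => integral_const_mul r _ }
  act :=
    { toFun := fun g => BoundedMeasurable.comp (g • ·) (measurable_const_smul g)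
      map_one' := by
        ext f x
        exact congrArg f (one_smul G x)
      map_mul' := fun g h => by
        ext f x
        exact congrArg f ((congrArg (· • x) (mul_comm g h)).trans (mul_smul h g x)) }
  state_mul_self_nonneg f := integral_nonneg fun x => mul_self_nonneg _
  state_mul_le f g := by
    change ∫ x, f x * g x * (f x * g x) ∂μ ≤ ‖f‖ ^ 2 * ∫ x, g x * g x ∂μ
    rw [← integral_const_mul]
    refine integral_mono ((f * g * (f * g)).integrable μ)
      (((g * g).integrable μ).const_mul _) fun x => ?_
    have hf : f x * f x ≤ ‖f‖ ^ 2 := by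
      rw [← sq]
      exact sq_le_sq.mpr ((f.norm_apply_le x).trans (le_abs_self _))
    rw [mul_mul_mul_comm]
    exact mul_le_mul_of_nonneg_right hf (mul_self_nonneg _)
  state_act g f := integral_smul_eq_self f
  norm_act_le g f :=
    lp.norm_le_of_forall_le (norm_nonneg f) fun x => f.norm_apply_le (g • x)

theorem norm_toLp_eq_norm_toL2 (f : BoundedMeasurable X) :
    ‖BoundedMeasurable.toLp μ f‖ = ‖(ofMeasure G μ).toL2 f‖ := by
  rw [← sq_eq_sq₀ (norm_nonneg _) (norm_nonneg _), BoundedMeasurable.norm_toLp_sq, norm_toL2_sq]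
  rfl

theorem finsetAverage_prodOrbit_ofMeasure_apply {d : ℕ} (s : Fin d → G)
    (a : Fin d → BoundedMeasurable X) (I : Finset ℤ) (x : X) :
    finsetAverage I ((ofMeasure G μ).prodOrbit s a) x =
      finsetAverage I fun n => ∏ i, a i (s i ^ n • x) := by
  refine (map_finsetAverage (BoundedMeasurable.eval x) I _).trans ?_
  simp only [prodOrbit_apply, map_prod]
  rfl

end OfMeasure

end InvariantState

section MeasurePreservingAction

variable {ι X G : Type*} [MeasurableSpace X] [CommGroup G] [MulAction G X]
  [MeasurableConstSMul G X] {μ : Measure X} [SMulInvariantMeasure G X μ]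

theorem finsetAverage_prod_smul_ae_eq {d : ℕ} (s : Fin d → G) {f f' : Fin d → X → ℝ}
    (h : ∀ i, f i =ᵐ[μ] f' i) (I : Finset ℤ) :
    (fun x => finsetAverage I fun n : ℤ => ∏ i, f i (s i ^ n • x)) =ᵐ[μ]
      fun x => finsetAverage I fun n : ℤ => ∏ i, f' i (s i ^ n • x) := by
  have hsmul : ∀ᵐ x ∂μ, ∀ i, ∀ n : ℤ, f i (s i ^ n • x) = f' i (s i ^ n • x) :=
    ae_all_iff.mpr fun i => ae_all_iff.mpr fun n =>
      (measurePreserving_smul (s i ^ n) μ).quasiMeasurePreserving.ae_eq_comp (h i)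
  filter_upwards [hsmul] with x hx
  simp only [hx]

theorem exists_tendsto_eLpNorm_finsetAverage_prod_smul [IsFiniteMeasure μ] {l : Filter ι}
    [NeBot l] {I : ι → Finset ℤ} (hI : IsAddFoelner ℤ Measure.count l fun j => (I j : Set ℤ))
    {d : ℕ} (s : Fin d → G) {f : Fin d → X → ℝ} (hf : ∀ i, MemLp (f i) ∞ μ) :
    (∀ j, MemLp (fun x => finsetAverage (I j) fun n : ℤ => ∏ i, f i (s i ^ n • x)) 2 μ) ∧
      ∃ g, MemLp g 2 μ ∧ Tendsto (fun j =>
        eLpNorm ((fun x => finsetAverage (I j) fun n : ℤ => ∏ i, f i (s i ^ n • x)) - g) 2 μ)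
          l (𝓝 0) := by
  choose a ha using fun i => BoundedMeasurable.exists_ae_eq (hf i)
  set σ := InvariantState.ofMeasure G μ
  have hrep (j : ι) : (fun x => finsetAverage (I j) fun n : ℤ => ∏ i, f i (s i ^ n • x)) =ᵐ[μ]
      (finsetAverage (I j) (σ.prodOrbit s a) : BoundedMeasurable X) :=
    (finsetAverage_prod_smul_ae_eq s ha (I j)).trans (Eventually.of_forall fun x =>
      (InvariantState.finsetAverage_prodOrbit_ofMeasure_apply G μ s a (I j) x).symm)
  have hmem j := (BoundedMeasurable.memLp (finsetAverage (I j) (σ.prodOrbit s a)) μ 2).ae_eq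
    (hrep j).symm
  obtain ⟨z, hz⟩ := σ.exists_tendsto_toL2_finsetAverage_prodOrbit hI s a
  let Φ : σ.L2 →L[ℝ] Lp ℝ 2 μ := (BoundedMeasurable.toLp μ).extendOfNorm σ.toL2
  have hΦ (b : BoundedMeasurable X) : Φ (σ.toL2 b) = BoundedMeasurable.toLp μ b :=
    LinearMap.extendOfNorm_eq σ.denseRange_toL2
      ⟨1, fun b => by rw [one_mul, InvariantState.norm_toLp_eq_norm_toL2 G μ b]⟩ b
  refine ⟨hmem, Φ z, Lp.memLp _, (Lp.tendsto_Lp_iff_tendsto_eLpNorm'' _ hmem _ (Lp.memLp _)).mp ?_⟩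
  rw [Lp.toLp_coeFn]
  refine ((Φ.continuous.tendsto z).comp hz).congr fun j => (hΦ _).trans ?_
  exact (MemLp.toLp_eq_toLp_iff
    (BoundedMeasurable.memLp (finsetAverage (I j) (σ.prodOrbit s a)) μ 2) (hmem j)).mpr
      (hrep j).symm

end MeasurePreservingAction

/-- The group of measure-preserving permutations with measure-preserving inverse. -/
def measurePreservingPerm {X : Type*} [MeasurableSpace X] (μ : Measure X) :
    Subgroup (Equiv.Perm X) where
  carrier := {g | MeasurePreserving g μ μ ∧ MeasurePreserving g.symm μ μ}
  mul_mem' hg hh := ⟨hg.1.comp hh.1, hh.2.comp hg.2⟩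
  one_mem' := ⟨MeasurePreserving.id μ, MeasurePreserving.id μ⟩
  inv_mem' hg := ⟨hg.2, hg.1⟩

theorem multipleAverage_eq_finsetAverage {X : Type*} [MeasurableSpace X] {d : ℕ}
    (S : Fin d → X ≃ᵐ X) (f : Fin d → X → ℝ) (I : Finset ℤ) :
    multipleAverage S f I = fun x => finsetAverage I fun n : ℤ =>
      ∏ i, f i (((S i).toEquiv : Equiv.Perm X) ^ n • x) := by
  ext x
  rw [multipleAverage, finsetAverage_apply, one_div]
  rfl

open scoped IsMulCommutative in
theorem theorem1p1_general {X : Type*} [MeasurableSpace X] (μ : Measure X) [IsFiniteMeasure μ]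
    (d : ℕ) (S : Fin d → X ≃ᵐ X)
    (hS : ∀ i, MeasurePreserving (S i) μ μ)
    (hcomm : ∀ i j, Function.Commute (S i) (S j))
    (f : Fin d → X → ℝ) (hf : ∀ i, MemLp (f i) ∞ μ)
    (I : ℕ → Finset ℤ) (hI : IsAddFoelner ℤ Measure.count atTop fun j => (I j : Set ℤ)) :
    ConvergesInL2 μ (fun j => multipleAverage S f (I j)) := by
  let K := Subgroup.closure (Set.range fun i => ((S i).toEquiv : Equiv.Perm X))
  have : IsMulCommutative K := Subgroup.isMulCommutative_closure (by
    rintro _ ⟨i, rfl⟩ _ ⟨j, rfl⟩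
    exact Equiv.ext (hcomm i j))
  have hK : K ≤ measurePreservingPerm μ := by
    rw [Subgroup.closure_le]
    rintro _ ⟨i, rfl⟩
    exact ⟨hS i, (hS i).symm (S i)⟩
  have : MeasurableConstSMul K X := ⟨fun g => (hK g.2).1.measurable⟩
  have : SMulInvariantMeasure K X μ :=
    ⟨fun g _ hs => (hK g.2).1.measure_preimage hs.nullMeasurableSet⟩
  let s (i : Fin d) : K := ⟨(S i).toEquiv, Subgroup.subset_closure ⟨i, rfl⟩⟩
  simp only [ConvergesInL2, multipleAverage_eq_finsetAverage]
  exact exists_tendsto_eLpNorm_finsetAverage_prod_smul hI s hf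

theorem theorem1p1 {X : Type*} [MeasurableSpace X] (μ : Measure X) [IsProbabilityMeasure μ]
    (d : ℕ) (S : Fin d → X ≃ᵐ X)
    (hS : ∀ i, MeasurePreserving (S i) μ μ)
    (hcomm : ∀ i j, Function.Commute (S i) (S j))
    (f : Fin d → X → ℝ) (hf : ∀ i, MemLp (f i) ∞ μ)
    (I : ℕ → Finset ℤ) (hI : ∀ j, (I j : Set ℤ).OrdConnected)
    (hlen : Tendsto (fun j => (I j).card) atTop atTop) :
    ConvergesInL2 μ (fun j => multipleAverage S f (I j)) :=
  theorem1p1_general μ d S hS hcomm f hf I (isAddFoelner_of_ordConnected hI hlen)
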